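/- **Theorem (Lopez-Escobar).** Let $L$ be a many-sorted relational vocabulary, i.e. a set of sorts together with a set of finitary relation symbols (no function or constant symbols), of any cardinality. There are countably many variables of each sort. Formulas of $L_{\omega_1\omega}$ are built from atomic formulas $R(x_1,\dots,x_n)$ and $x=y$ (with variables of arbitrary sorts) by negation, conjunctions and disjunctions of at most countable, possibly empty, families of formulas, and the quantifiers $\forall x$, $\exists x$; sentences have no free variables. A structure consists of a non-empty domain $M_s$ for each sort $s$ (the domains need not be disjoint) and, for each relation symbol, a relation of its arity on $\bigcup_s M_s$; quantified variables of sort $s$ range over $M_s$, and $=$ is identity. For sentences, $\varphi\models\psi$ means that every structure that satisfies $\varphi$ satisfies $\psi$. Let $\tau(\varphi)$ be the set of sorts and relation symbols occurring in $\varphi$ (a sort occurs if a variable of that sort occurs, possibly only in a quantifier). Let $\mathrm{Un}(\varphi)$ be the set of sorts of variables that occur universally quantified in $\varphi$, i.e. bound by a $\forall$ in the scope of an even number of negations or by an $\exists$ in the scope of an odd number of negations; and let $\mathrm{Ex}(\varphi)$ be the set of sorts of variables that occur existentially quantified in $\varphi$, defined in the same way with $\forall$ and $\exists$ interchanged. Suppose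 that $\varphi\models\psi$, where $\varphi$ and $\psi$ are sentences of $L_{\omega_1\omega}$. Then there is a sentence $\theta$ of $L_{\omega_1\omega}$ such that 1. $\varphi\models\theta$ and $\theta\models\psi$; 2. $\tau(\theta)\subseteq\tau(\varphi)\cap\tau(\psi)$; 3. $\mathrm{Un}(\theta)\subseteq\mathrm{Un}(\varphi)$ and $\mathrm{Ex}(\theta)\subseteq\mathrm{Ex}(\psi)$. Moreover, $\theta$ can be chosen so that it respects every assignment of argument sorts to the relation symbols that both $\varphi$ and $\psi$ respect (a formula respects such an assignment if in its atomic formulas every relation symbol is applied to variables of the assigned sorts and $=$ stands only between variables of the same sort). Hence the theorem also holds in strictly typed many-sorted logic. -/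

import Mathlib

universe u v w

namespace ManySorted

/-- A many-sorted relational vocabulary: a set of sorts and a set of finitary relation symbols
(no function or constant symbols). A relation symbol may be applied to variables of any sorts;
assignments of argument sorts to relation symbols are treated by `Formula.RespectsType`. -/
structure Vocabulary where
  /-- the sorts -/
  Srt : Type u
  /-- the relation symbols -/
  Rel : Type v
  /-- the number of arguments of a relation symbol -/
  arity : Rel → ℕ

/-- The variables `x_n^s`: countably many of each sort `s`. -/
structure Var (L : Vocabulary.{u, v}) where
  /-- the sort of the variable -/
  sort : L.Srt
  /-- the index of the variable among those of its sort -/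
  index : ℕ

/-- The formulas of the infinitary logic `L_{ω₁ω}`: conjunctions and disjunctions of at most
countable (possibly finite or empty) families of formulas, quantification over one variable at
a time. Equality is a logical symbol and may relate variables of different sorts. -/
inductive Formula (L : Vocabulary.{u, v}) : Type (max u v)
  | rel (R : L.Rel) (x : Fin (L.arity R) → Var L) : Formula L
  | eq (x y : Var L) : Formula L
  | neg (φ : Formula L) : Formula L
  | conj (I : Set ℕ) (φ : I → Formula L) : Formula L
  | disj (I : Set ℕ) (φ : I → Formula L) : Formula L
  | all (x : Var L) (φ : Formula L) : Formula L
  | ex (x : Var L) (φ : Formula L) : Formula L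

/-- A many-sorted structure: non-empty domains `dom s`, one for each sort `s`, which need not be
disjoint, and relations on their union `Carrier`. -/
structure Model (L : Vocabulary.{u, v}) where
  /-- the union of the domains -/
  Carrier : Type w
  /-- the domain of a sort -/
  dom : L.Srt → Set Carrier
  dom_nonempty : ∀ s, (dom s).Nonempty
  exists_mem_dom : ∀ a, ∃ s, a ∈ dom s
  /-- the interpretation of a relation symbol -/
  rel : (R : L.Rel) → (Fin (L.arity R) → Carrier) → Prop

namespace Formula

variable {L : Vocabulary.{u, v}}

/-- The variables that occur free in a formula. -/
def freeVars : Formula L → Set (Var L)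
  | rel _ x => Set.range x
  | eq x y => {x, y}
  | neg φ => φ.freeVars
  | conj _ φ => ⋃ i, (φ i).freeVars
  | disj _ φ => ⋃ i, (φ i).freeVars
  | all x φ => φ.freeVars \ {x}
  | ex x φ => φ.freeVars \ {x}

/-- A sentence is a formula without free variables. -/
def IsSentence (φ : Formula L) : Prop := φ.freeVars = ∅

/-- The sorts that occur in a formula: those of the variables occurring in it, be it in an
atomic subformula or in a quantifier. -/
def sorts : Formula L → Set L.Srt
  | rel _ x => Set.range fun i => (x i).sort
  | eq x y => {x.sort, y.sort}
  | neg φ => φ.sorts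
  | conj _ φ => ⋃ i, (φ i).sorts
  | disj _ φ => ⋃ i, (φ i).sorts
  | all x φ => insert x.sort φ.sorts
  | ex x φ => insert x.sort φ.sorts

/-- The relation symbols that occur in a formula. -/
def relSymbols : Formula L → Set L.Rel
  | rel R _ => {R}
  | eq _ _ => ∅
  | neg φ => φ.relSymbols
  | conj _ φ => ⋃ i, (φ i).relSymbols
  | disj _ φ => ⋃ i, (φ i).relSymbols
  | all _ φ => φ.relSymbols
  | ex _ φ => φ.relSymbols

/-- The vocabulary `τ(φ)` of a formula: the sorts and the relation symbols occurring in it. -/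
def voc (φ : Formula L) : Set (L.Srt ⊕ L.Rel) :=
  Sum.inl '' φ.sorts ∪ Sum.inr '' φ.relSymbols

mutual

/-- `Un(φ)`: the sorts of the variables that occur universally quantified in `φ`, that is,
by `∀` below an even number of negations or by `∃` below an odd number of negations. -/
def Un : Formula L → Set L.Srt
  | rel _ _ => ∅
  | eq _ _ => ∅
  | neg φ => φ.Ex
  | conj _ φ => ⋃ i, (φ i).Un
  | disj _ φ => ⋃ i, (φ i).Un
  | all x φ => insert x.sort φ.Un
  | ex _ φ => φ.Un

/-- `Ex(φ)`: the sorts of the variables that occur existentially quantified in `φ`, that is,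
by `∃` below an even number of negations or by `∀` below an odd number of negations. -/
def Ex : Formula L → Set L.Srt
  | rel _ _ => ∅
  | eq _ _ => ∅
  | neg φ => φ.Un
  | conj _ φ => ⋃ i, (φ i).Ex
  | disj _ φ => ⋃ i, (φ i).Ex
  | all _ φ => φ.Ex
  | ex x φ => insert x.sort φ.Ex

end

/-- Given an assignment `ty` of argument sorts to the relation symbols, `φ` is a formula of
strictly typed many-sorted logic: every relation symbol is applied to variables of the prescribed
sorts, and equality relates only variables of the same sort. -/
def RespectsType (ty : (R : L.Rel) → Fin (L.arity R) → L.Srt) : Formula L → Prop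
  | rel R x => ∀ i, (x i).sort = ty R i
  | eq x y => x.sort = y.sort
  | neg φ => φ.RespectsType ty
  | conj _ φ => ∀ i, (φ i).RespectsType ty
  | disj _ φ => ∀ i, (φ i).RespectsType ty
  | all _ φ => φ.RespectsType ty
  | ex _ φ => φ.RespectsType ty

open scoped Classical in
/-- Satisfaction of a formula in `M` under an assignment of elements to the variables. -/
def Realize (M : Model.{u, v, w} L) : Formula L → (Var L → M.Carrier) → Prop
  | rel R x, e => M.rel R fun i => e (x i)
  | eq x y, e => e x = e y
  | neg φ, e => ¬ φ.Realize M e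
  | conj _ φ, e => ∀ i, (φ i).Realize M e
  | disj _ φ, e => ∃ i, (φ i).Realize M e
  | all x φ, e => ∀ a ∈ M.dom x.sort, φ.Realize M (Function.update e x a)
  | ex x φ, e => ∃ a ∈ M.dom x.sort, φ.Realize M (Function.update e x a)

/-- `M ⊨ φ`: satisfaction under all assignments that respect sorts; such assignments exist, and
for a sentence the choice of the assignment does not matter. -/
def Holds (M : Model.{u, v, w} L) (φ : Formula L) : Prop :=
  ∀ e : Var L → M.Carrier, (∀ x, e x ∈ M.dom x.sort) → φ.Realize M e

/-- `φ ⊨ ψ`: every structure that satisfies `φ` satisfies `ψ`. -/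
def Entails (φ ψ : Formula L) : Prop :=
  ∀ M : Model.{u, v, w} L, Holds M φ → Holds M ψ

end Formula

end ManySorted

namespace ManySorted

-- The proof is a tableau argument about inseparability. Items are signed formulas on two sides; the
-- start is `φ` asserted on side `true` and `ψ` denied on side `false`. A finite set of items is
-- separable if some formula within the syntactic bounds, with free variables occurring on both
-- sides, follows from one side and is refuted by the other. A separator of the starting pair is the
-- required interpolant.
--
-- If a tableau rule is applied and all resulting branches are separable, so is the original set
-- (`separable_of_expand`). Hence an inseparable set lies on an open branch (`exists_open_branch`).
-- Clashes are separable (`separable_of_eq_clash`, `separable_of_rel_clash`), so the union of the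
-- branch is a Hintikka set, and its canonical model satisfies `φ` but not `ψ` (`IsHintikka.sat`).
--
-- The control of quantifiers comes from `separable_of_instance`: a separator acquires a quantifier
-- only when a universal item of one side is instantiated at a variable otherwise absent from that
-- side. Seen from the side of `φ`, this gives universal quantifiers over sorts in `φ.Un` and
-- existential ones over sorts in `ψ.Ex`.
--
-- Equality has no tableau rules. The equations of a branch generate an equivalence relation,
-- clashes are taken modulo it, and the separator of a clash conjoins equations between common
-- variables, possibly with one atom.

variable {L : Vocabulary.{u, v}}

/-- Assignments that send each variable to an element of the domain of its sort. -/
def Model.Respects (M : Model.{u, v, w} L) (e : Var L → M.Carrier) : Prop :=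
  ∀ x, e x ∈ M.dom x.sort

open scoped Classical in
theorem Model.Respects.update {M : Model.{u, v, w} L} {e : Var L → M.Carrier}
    (he : M.Respects e) {c : Var L} {a : M.Carrier} (ha : a ∈ M.dom c.sort) :
    M.Respects (Function.update e c a) := by
  intro x
  by_cases h : x = c
  · subst h; simpa using ha
  · simpa [h] using he x

-- Coincidence, countable disjunctions and conjunctions

namespace Formula

theorem realize_congr (M : Model.{u, v, w} L) (φ : Formula L) :
    ∀ {e e' : Var L → M.Carrier}, (∀ x ∈ φ.freeVars, e x = e' x) →
      (φ.Realize M e ↔ φ.Realize M e') := by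
  classical
  induction φ with
  | rel R x =>
    intro e e' h
    have : (fun i => e (x i)) = fun i => e' (x i) := funext fun i => h _ ⟨i, rfl⟩
    simp only [Realize, this]
  | eq x y =>
    intro e e' h
    simp only [Realize, h x (Or.inl rfl), h y (Or.inr rfl)]
  | neg φ ih => intro e e' h; exact not_congr (ih h)
  | conj I φ ih =>
    intro e e' h
    exact forall_congr' fun i => ih i fun x hx => h x (Set.mem_iUnion_of_mem i hx)
  | disj I φ ih =>
    intro e e' h
    exact exists_congr fun i => ih i fun x hx => h x (Set.mem_iUnion_of_mem i hx)
  | all y φ ih =>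
    intro e e' h
    refine forall_congr' fun a => forall_congr' fun _ => ih fun x hx => ?_
    by_cases hxy : x = y
    · subst hxy; simp
    · simpa [hxy] using h x ⟨hx, hxy⟩
  | ex y φ ih =>
    intro e e' h
    refine exists_congr fun a => and_congr_right fun _ => ih fun x hx => ?_
    by_cases hxy : x = y
    · subst hxy; simp
    · simpa [hxy] using h x ⟨hx, hxy⟩

/-- The disjunction of a countable family of formulas. -/
noncomputable def cDisj {ι : Type*} [Countable ι] (f : ι → Formula L) : Formula L :=
  disj (Set.range (Classical.choose (Countable.exists_injective_nat ι)))
    fun n => f (Classical.choose n.2)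

theorem exists_range_choose {ι : Type*} [Countable ι] (p : ι → Prop) :
    (∃ n : Set.range (Classical.choose (Countable.exists_injective_nat ι)),
      p (Classical.choose n.2)) ↔ ∃ i, p i := by
  constructor
  · rintro ⟨n, hn⟩; exact ⟨_, hn⟩
  · rintro ⟨i, hi⟩
    refine ⟨⟨_, i, rfl⟩, ?_⟩
    have h := Classical.choose_spec (Set.mem_range_self
      (f := Classical.choose (Countable.exists_injective_nat ι)) i)
    -- The chosen preimage is `i` itself because the numbering of `ι` is injective.
    rwa [Classical.choose_spec (Countable.exists_injective_nat ι) h]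

theorem realize_cDisj {ι : Type*} [Countable ι] (f : ι → Formula L) (M : Model.{u, v, w} L)
    (e : Var L → M.Carrier) : (cDisj f).Realize M e ↔ ∃ i, (f i).Realize M e :=
  exists_range_choose fun i => (f i).Realize M e

theorem freeVars_cDisj_subset {ι : Type*} [Countable ι] {f : ι → Formula L} {V : Set (Var L)}
    (h : ∀ i, (f i).freeVars ⊆ V) : (cDisj f).freeVars ⊆ V :=
  Set.iUnion_subset fun _ => h _

end Formula

namespace Formula

/-- The conjunction of a countable family of formulas. -/
noncomputable def cConj {ι : Type*} [Countable ι] (f : ι → Formula L) : Formula L :=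
  neg (cDisj fun i => neg (f i))

theorem realize_cConj {ι : Type*} [Countable ι] (f : ι → Formula L) (M : Model.{u, v, w} L)
    (e : Var L → M.Carrier) : (cConj f).Realize M e ↔ ∀ i, (f i).Realize M e := by
  rw [cConj, Realize, realize_cDisj]
  simp [Realize]

theorem freeVars_cConj_subset {ι : Type*} [Countable ι] {f : ι → Formula L} {V : Set (Var L)}
    (h : ∀ i, (f i).freeVars ⊆ V) : (cConj f).freeVars ⊆ V :=
  freeVars_cDisj_subset (f := fun i => neg (f i)) h

end Formula

-- Syntactic bounds on separators

/-- The syntactic bounds on an interpolant. The two sides are indexed by `Bool`; `srt`, `rels` and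
`un` bound the sorts, relation symbols and universally quantified sorts of the formulas on each
side, and `typ` is a set of assignments of argument sorts respected by all formulas. -/
structure Bounds (L : Vocabulary.{u, v}) where
  /-- the sorts allowed on a side -/
  srt : Bool → Set L.Srt
  /-- the relation symbols allowed on a side -/
  rels : Bool → Set L.Rel
  /-- the sorts that may be quantified universally on a side -/
  un : Bool → Set L.Srt
  /-- the assignments of argument sorts to be respected -/
  typ : Set ((R : L.Rel) → Fin (L.arity R) → L.Srt)

/-- `θ` obeys the bounds for a formula that follows from side `i` and contradicts side `!i`. -/
structure Bounds.Fits (B : Bounds L) (i : Bool) (θ : Formula L) : Prop where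
  sorts : θ.sorts ⊆ B.srt i ∩ B.srt (!i)
  relSymbols : θ.relSymbols ⊆ B.rels i ∩ B.rels (!i)
  un : θ.Un ⊆ B.un i
  ex : θ.Ex ⊆ B.un (!i)
  typ : ∀ ty ∈ B.typ, θ.RespectsType ty

namespace Bounds.Fits

variable {B : Bounds L} {i : Bool}

/-- Negation exchanges `Un` and `Ex`, just as changing sides exchanges their bounds. -/
theorem neg {θ : Formula L} (h : B.Fits i θ) : B.Fits (!i) θ.neg where
  sorts := by rw [Bool.not_not, Set.inter_comm]; exact h.sorts
  relSymbols := by rw [Bool.not_not, Set.inter_comm]; exact h.relSymbols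
  un := h.ex
  ex := by rw [Bool.not_not]; exact h.un
  typ := h.typ

theorem cDisj {ι : Type*} [Countable ι] {f : ι → Formula L} (h : ∀ j, B.Fits i (f j)) :
    B.Fits i (Formula.cDisj f) where
  sorts := Set.iUnion_subset fun _ => (h _).sorts
  relSymbols := Set.iUnion_subset fun _ => (h _).relSymbols
  un := Set.iUnion_subset fun _ => (h _).un
  ex := Set.iUnion_subset fun _ => (h _).ex
  typ := fun ty hty _ => (h _).typ ty hty

theorem cConj {ι : Type*} [Countable ι] {f : ι → Formula L} (h : ∀ j, B.Fits i (f j)) :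
    B.Fits i (Formula.cConj f) := by
  -- By De Morgan, two changes of side reduce the conjunction to the disjunction.
  have := (Bounds.Fits.cDisj fun j => (h j).neg).neg
  rwa [Bool.not_not] at this

theorem all {θ : Formula L} {c : Var L} (h : B.Fits i θ) (hc : c.sort ∈ B.srt i)
    (hc' : c.sort ∈ B.srt (!i)) (hu : c.sort ∈ B.un i) : B.Fits i (θ.all c) where
  sorts := Set.insert_subset ⟨hc, hc'⟩ h.sorts
  relSymbols := h.relSymbols
  un := Set.insert_subset hu h.un
  ex := h.ex
  typ := h.typ

end Bounds.Fits

-- Signed items with substitutions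

/-- A node of a tableau: a formula, asserted or denied on one of two sides, with a substitution of
variables for its free variables. -/
structure Item (L : Vocabulary.{u, v}) where
  /-- the side on which the item stands -/
  side : Bool
  /-- whether the formula is asserted or denied -/
  sign : Bool
  /-- the formula -/
  form : Formula L
  /-- the substitution applied to the free variables -/
  sub : Var L → Var L

namespace Item

/-- The variables that occur free in an item. -/
def vars (ι : Item L) : Set (Var L) := ι.sub '' ι.form.freeVars

/-- Truth of an item. -/
def Sat (M : Model.{u, v, w} L) (e : Var L → M.Carrier) (ι : Item L) : Prop :=
  ι.form.Realize M (e ∘ ι.sub) ↔ ι.sign = true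

theorem sat_congr {M : Model.{u, v, w} L} {e e' : Var L → M.Carrier} {ι : Item L}
    (h : ∀ x ∈ ι.vars, e x = e' x) : ι.Sat M e ↔ ι.Sat M e' := by
  unfold Sat
  rw [Formula.realize_congr M ι.form (e := e ∘ ι.sub) (e' := e' ∘ ι.sub)
    fun x hx => h _ ⟨x, hx, rfl⟩]

open scoped Classical in
theorem sat_update {M : Model.{u, v, w} L} {e : Var L → M.Carrier} {ι : Item L} {c : Var L}
    {a : M.Carrier} (hc : c ∉ ι.vars) : ι.Sat M (Function.update e c a) ↔ ι.Sat M e :=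
  sat_congr fun x hx => Function.update_of_ne (fun h : x = c => hc (h ▸ hx)) _ _

/-- The item obeys the bounds of its side. -/
structure Good (B : Bounds L) (ι : Item L) : Prop where
  sorts : ι.form.sorts ⊆ B.srt ι.side
  relSymbols : ι.form.relSymbols ⊆ B.rels ι.side
  un : (if ι.sign then ι.form.Un else ι.form.Ex) ⊆ B.un ι.side
  typ : ∀ ty ∈ B.typ, ι.form.RespectsType ty
  finite : ι.form.freeVars.Finite
  sub : ∀ x, (ι.sub x).sort = x.sort

end Item

theorem Formula.sort_mem_sorts_of_mem_freeVars {φ : Formula L} {x : Var L}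
    (h : x ∈ φ.freeVars) : x.sort ∈ φ.sorts := by
  induction φ with
  | rel R y => obtain ⟨i, rfl⟩ := h; exact ⟨i, rfl⟩
  | eq y z => rcases h with rfl | rfl <;> simp [sorts]
  | neg φ ih => exact ih h
  | conj I φ ih =>
    obtain ⟨i, hi⟩ := Set.mem_iUnion.1 h
    exact Set.mem_iUnion_of_mem i (ih i hi)
  | disj I φ ih =>
    obtain ⟨i, hi⟩ := Set.mem_iUnion.1 h
    exact Set.mem_iUnion_of_mem i (ih i hi)
  | all y φ ih => exact Or.inr (ih h.1)
  | ex y φ ih => exact Or.inr (ih h.1)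

namespace Item.Good

theorem sort_mem {B : Bounds L} {ι : Item L} (h : ι.Good B) {x : Var L} (hx : x ∈ ι.vars) :
    x.sort ∈ B.srt ι.side := by
  obtain ⟨y, hy, rfl⟩ := hx
  rw [h.sub]
  exact h.sorts (Formula.sort_mem_sorts_of_mem_freeVars hy)

end Item.Good

-- Separability and its preservation under rules

/-- The variables that occur free on side `i`. -/
def sideVars (i : Bool) (Γ : Set (Item L)) : Set (Var L) :=
  {x | ∃ ι ∈ Γ, ι.side = i ∧ x ∈ ι.vars}

/-- The items on side `i` are true. -/
def SideSat (M : Model.{u, v, w} L) (e : Var L → M.Carrier) (i : Bool) (Γ : Set (Item L)) : Prop :=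
  ∀ ι ∈ Γ, ι.side = i → ι.Sat M e

/-- `θ` separates side `i` from side `!i`. -/
structure Separates (B : Bounds L) (i : Bool) (Γ : Set (Item L)) (θ : Formula L) : Prop where
  freeVars : θ.freeVars ⊆ sideVars i Γ ∩ sideVars (!i) Γ
  fits : B.Fits i θ
  left : ∀ (M : Model.{u, v, w} L) (e : Var L → M.Carrier), M.Respects e →
    SideSat M e i Γ → θ.Realize M e
  right : ∀ (M : Model.{u, v, w} L) (e : Var L → M.Carrier), M.Respects e →
    SideSat M e (!i) Γ → ¬ θ.Realize M e

/-- Some formula separates side `i` from side `!i`. -/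
def Separable (B : Bounds L) (i : Bool) (Γ : Set (Item L)) : Prop :=
  ∃ θ, Separates.{u, v, w} B i Γ θ

theorem Separates.neg {B : Bounds L} {i : Bool} {Γ : Set (Item L)} {θ : Formula L}
    (h : Separates.{u, v, w} B i Γ θ) : Separates.{u, v, w} B (!i) Γ θ.neg where
  freeVars := by rw [Bool.not_not, Set.inter_comm]; exact h.freeVars
  fits := h.fits.neg
  left := h.right
  right := by rw [Bool.not_not]; exact fun M e he hs => not_not.2 (h.left M e he hs)

/-- By this symmetry each rule need only be treated from the side of the item it acts on. -/
theorem Separable.change_side {B : Bounds L} {i : Bool} {Γ : Set (Item L)}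
    (h : Separable.{u, v, w} B i Γ) (j : Bool) : Separable.{u, v, w} B j Γ := by
  obtain ⟨θ, hθ⟩ := h
  by_cases hij : j = i
  · exact hij ▸ ⟨θ, hθ⟩
  · obtain rfl : j = !i := by revert hij; cases i <;> cases j <;> simp
    exact ⟨_, hθ.neg⟩

section Rules

variable {B : Bounds L} {Γ : Set (Item L)} {ι : Item L}

theorem mem_sideVars_insert {i : Bool} {κ : Item L} {x : Var L} :
    x ∈ sideVars i (insert κ Γ) ↔ (κ.side = i ∧ x ∈ κ.vars) ∨ x ∈ sideVars i Γ := by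
  simp [sideVars]

theorem sideVars_not_insert {κ : Item L} (h : κ.side = ι.side) :
    sideVars (!ι.side) (insert κ Γ) = sideVars (!ι.side) Γ := by
  ext x
  simp [mem_sideVars_insert, h]

theorem sideSat_insert {M : Model.{u, v, w} L} {e : Var L → M.Carrier} {i : Bool} {κ : Item L} :
    SideSat M e i (insert κ Γ) ↔ (κ.side = i → κ.Sat M e) ∧ SideSat M e i Γ := by
  simp [SideSat]

theorem sideSat_not_insert {M : Model.{u, v, w} L} {e : Var L → M.Carrier} {κ : Item L}
    (h : κ.side = ι.side) :
    SideSat M e (!ι.side) (insert κ Γ) ↔ SideSat M e (!ι.side) Γ := by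
  simp [sideSat_insert, h]

open scoped Classical in
theorem sideSat_update {M : Model.{u, v, w} L} {e : Var L → M.Carrier} {i : Bool} {c : Var L}
    {a : M.Carrier} (hc : c ∉ sideVars i Γ) (h : SideSat M e i Γ) :
    SideSat M (Function.update e c a) i Γ :=
  fun κ hκ hi => (Item.sat_update fun hx => hc ⟨κ, hκ, hi, hx⟩).2 (h κ hκ hi)

/-- The disjunction of the separators of the branches works: the acting side makes one branch true,
and the other side is the same in all branches. -/
theorem separable_of_branches {J : Type*} [Countable J] (κ : J → Item L) (hι : ι ∈ Γ)
    (hside : ∀ j, (κ j).side = ι.side) (hvars : ∀ j, (κ j).vars ⊆ ι.vars)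
    (hsat : ∀ (M : Model.{u, v, w} L) (e : Var L → M.Carrier), M.Respects e → ι.Sat M e →
      ∃ j, (κ j).Sat M e)
    (h : ∀ j, Separable.{u, v, w} B ι.side (insert (κ j) Γ)) :
    Separable.{u, v, w} B ι.side Γ := by
  choose θ hθ using h
  refine ⟨Formula.cDisj θ, Formula.freeVars_cDisj_subset fun j x hx => ?_,
    Bounds.Fits.cDisj fun j => (hθ j).fits, fun M e he hs => ?_, fun M e he hs => ?_⟩
  · have := (hθ j).freeVars hx
    rw [sideVars_not_insert (hside j)] at this
    refine ⟨?_, this.2⟩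
    rcases mem_sideVars_insert.1 this.1 with h | h
    · exact ⟨ι, hι, rfl, hvars j h.2⟩
    · exact h
  · obtain ⟨j, hj⟩ := hsat M e he (hs ι hι rfl)
    exact (Formula.realize_cDisj _ _ _).2
      ⟨j, (hθ j).left M e he (sideSat_insert.2 ⟨fun _ => hj, hs⟩)⟩
  · rw [Formula.realize_cDisj]
    rintro ⟨j, hj⟩
    exact (hθ j).right M e he ((sideSat_not_insert (hside j)).2 hs) hj

/-- The old separator still separates, but `c` may be free in it without occurring on the acting
side of `Γ`. In that case `c` is arbitrary for this side and can be quantified universally. -/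
theorem separable_of_instance {κ : Item L} {c : Var L} (hΓ : ∀ κ ∈ Γ, κ.Good B) (hι : ι ∈ Γ)
    (hside : κ.side = ι.side) (hvars : κ.vars ⊆ insert c ι.vars)
    (hsat : ∀ (M : Model.{u, v, w} L) (e : Var L → M.Carrier), M.Respects e → ι.Sat M e →
      κ.Sat M e)
    (hsrt : c.sort ∈ B.srt ι.side) (hun : c.sort ∈ B.un ι.side)
    (h : Separable.{u, v, w} B ι.side (insert κ Γ)) : Separable.{u, v, w} B ι.side Γ := by
  classical
  obtain ⟨θ, hθ⟩ := h
  have hfree := hθ.freeVars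
  rw [sideVars_not_insert hside] at hfree
  have hfree' : ∀ x ∈ θ.freeVars, x ≠ c → x ∈ sideVars ι.side Γ := by
    intro x hx hxc
    rcases mem_sideVars_insert.1 (hfree hx).1 with h | h
    · rcases hvars h.2 with h | h
      · exact absurd h hxc
      · exact ⟨ι, hι, rfl, h⟩
    · exact h
  have hleft : ∀ (M : Model.{u, v, w} L) (e : Var L → M.Carrier), M.Respects e →
      SideSat M e ι.side Γ → θ.Realize M e := fun M e he hs =>
    hθ.left M e he (sideSat_insert.2 ⟨fun _ => hsat M e he (hs ι hι rfl), hs⟩)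
  have hright := hθ.right
  simp only [sideSat_not_insert hside] at hright
  by_cases hc : c ∈ sideVars ι.side Γ ∨ c ∉ θ.freeVars
  · refine ⟨θ, fun x hx => ⟨?_, (hfree hx).2⟩, hθ.fits, hleft, hright⟩
    by_cases hxc : x = c
    · subst hxc; exact hc.resolve_right (not_not.2 hx)
    · exact hfree' x hx hxc
  · push Not at hc
    obtain ⟨κ', hκ', hside', hcκ'⟩ := (hfree hc.2).2
    -- The sort of `c` is allowed on the opposite side because `c` occurs there.
    refine ⟨θ.all c, fun x hx => ⟨hfree' x hx.1 hx.2, (hfree hx.1).2⟩,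
      hθ.fits.all hsrt (hside' ▸ (hΓ κ' hκ').sort_mem hcκ') hun, fun M e he hs a ha => ?_,
      fun M e he hs hall => ?_⟩
    · exact hleft M _ (he.update ha) (sideSat_update hc.1 hs)
    · have := hall (e c) (he c)
      rw [Function.update_eq_self] at this
      exact hright M e he hs this

/-- The fresh `c` does not occur on the opposite side, hence not in the separator, which therefore
serves unchanged and gains no quantifier. -/
theorem separable_of_witness {κ : Item L} {c : Var L} (hι : ι ∈ Γ) (hside : κ.side = ι.side)
    (hvars : κ.vars ⊆ insert c ι.vars) (hc : ∀ i, c ∉ sideVars i Γ)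
    (hsat : ∀ (M : Model.{u, v, w} L) (e : Var L → M.Carrier), M.Respects e → ι.Sat M e →
      ∃ a ∈ M.dom c.sort, ∀ e', (∀ x, x ≠ c → e' x = e x) → e' c = a → κ.Sat M e')
    (h : Separable.{u, v, w} B ι.side (insert κ Γ)) : Separable.{u, v, w} B ι.side Γ := by
  classical
  obtain ⟨θ, hθ⟩ := h
  have hfree := hθ.freeVars
  have hright := hθ.right
  rw [sideVars_not_insert hside] at hfree
  simp only [sideSat_not_insert hside] at hright
  have hcθ : c ∉ θ.freeVars := fun h => hc _ (hfree h).2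
  refine ⟨θ, fun x hx => ⟨?_, (hfree hx).2⟩, hθ.fits, fun M e he hs => ?_, hright⟩
  · rcases mem_sideVars_insert.1 (hfree hx).1 with h | h
    · rcases hvars h.2 with h | h
      · exact absurd (Set.mem_singleton_iff.1 h ▸ hx) hcθ
      · exact ⟨ι, hι, rfl, h⟩
    · exact h
  · obtain ⟨a, ha, hκ⟩ := hsat M e he (hs ι hι rfl)
    rw [Formula.realize_congr M θ (e' := Function.update e c a) fun x hx =>
      (Function.update_of_ne (fun h : x = c => hcθ (h ▸ hx)) _ _).symm]
    exact hθ.left M _ (he.update ha) (sideSat_insert.2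
      ⟨fun _ => hκ _ (fun x hx => Function.update_of_ne hx _ _) (Function.update_self _ _ _),
        sideSat_update (hc _) hs⟩)

end Rules

-- Tableau rules

namespace Item

open scoped Classical in
/-- The item for the instance of a quantified formula at the `n`-th variable. -/
noncomputable def inst (i b : Bool) (x : Var L) (φ : Formula L) (σ : Var L → Var L) (n : ℕ) :
    Item L :=
  ⟨i, b, φ, Function.update σ x ⟨x.sort, n⟩⟩

/-- The tableau rules: for each set in `expand ι`, a branch that contains `ι` is to be extended by
some member of that set. -/
noncomputable def expand : Item L → Set (Set (Item L))
  | ⟨_, _, .rel _ _, _⟩ => ∅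
  | ⟨_, _, .eq _ _, _⟩ => ∅
  | ⟨i, b, .neg φ, σ⟩ => {{⟨i, !b, φ, σ⟩}}
  | ⟨i, true, .conj _ φ, σ⟩ => Set.range fun j => {⟨i, true, φ j, σ⟩}
  | ⟨i, false, .conj _ φ, σ⟩ => {Set.range fun j => ⟨i, false, φ j, σ⟩}
  | ⟨i, true, .disj _ φ, σ⟩ => {Set.range fun j => ⟨i, true, φ j, σ⟩}
  | ⟨i, false, .disj _ φ, σ⟩ => Set.range fun j => {⟨i, false, φ j, σ⟩}
  | ⟨i, true, .all x φ, σ⟩ => Set.range fun n => {inst i true x φ σ n}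
  | ⟨i, false, .all x φ, σ⟩ => {Set.range fun n => inst i false x φ σ n}
  | ⟨i, true, .ex x φ, σ⟩ => {Set.range fun n => inst i true x φ σ n}
  | ⟨i, false, .ex x φ, σ⟩ => Set.range fun n => {inst i false x φ σ n}

theorem countable_expand (ι : Item L) : ι.expand.Countable := by
  obtain ⟨i, b, φ, σ⟩ := ι
  cases φ <;> cases b <;>
    simp [expand, Set.countable_range]

theorem countable_of_mem_expand {ι : Item L} {A : Set (Item L)} (h : A ∈ ι.expand) :
    A.Countable := by
  obtain ⟨i, b, φ, σ⟩ := ι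
  cases φ <;> cases b <;> simp only [expand, Set.mem_singleton_iff, Set.mem_range,
    Set.mem_empty_iff_false] at h
  all_goals first
    | (subst h; first | exact Set.countable_singleton _ | exact Set.countable_range _)
    | (obtain ⟨_, rfl⟩ := h; exact Set.countable_singleton _)

theorem Good.inst {B : Bounds L} {i b : Bool} {x : Var L} {φ : Formula L} {σ : Var L → Var L}
    (hs : φ.sorts ⊆ B.srt i) (hr : φ.relSymbols ⊆ B.rels i)
    (hu : (if b then φ.Un else φ.Ex) ⊆ B.un i) (ht : ∀ ty ∈ B.typ, φ.RespectsType ty)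
    (hf : (φ.freeVars \ {x}).Finite) (hσ : ∀ y, (σ y).sort = y.sort) (n : ℕ) :
    (inst i b x φ σ n).Good B := by
  classical
  refine ⟨hs, hr, hu, ht, (hf.insert x).subset fun y hy => ?_, fun y => ?_⟩
  · by_cases h : y = x
    · exact Or.inl h
    · exact Or.inr ⟨hy, h⟩
  · by_cases h : y = x
    · subst h; simp [Item.inst]
    · simp [Item.inst, h, hσ]

theorem vars_inst_subset {i b b' : Bool} {x : Var L} {φ ψ : Formula L} {σ : Var L → Var L} {n : ℕ}
    (h : ψ.freeVars = φ.freeVars \ {x}) :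
    (inst i b x φ σ n).vars ⊆ insert ⟨x.sort, n⟩ (Item.mk i b' ψ σ).vars := by
  classical
  rintro _ ⟨y, hy, rfl⟩
  by_cases hxy : y = x
  · subst hxy; left; simp [inst]
  · right
    refine ⟨y, ?_, by simp [inst, hxy]⟩
    rw [h]
    exact ⟨hy, hxy⟩

open scoped Classical in
theorem sat_inst {M : Model.{u, v, w} L} {e : Var L → M.Carrier} {i b : Bool} {x : Var L}
    {φ : Formula L} {σ : Var L → Var L} {n : ℕ} :
    (inst i b x φ σ n).Sat M e ↔
      (φ.Realize M (Function.update (e ∘ σ) x (e ⟨x.sort, n⟩)) ↔ b = true) := by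
  unfold Sat inst
  dsimp only
  rw [Function.comp_update]

/-- Finiteness of the free variables is among the inherited properties: an arbitrary formula can
have infinitely many, but a rule strips at most one quantifier. -/
theorem Good.of_mem_expand {B : Bounds L} {ι κ : Item L} (h : ι.Good B) {A : Set (Item L)}
    (hA : A ∈ ι.expand) (hκ : κ ∈ A) : κ.Good B := by
  obtain ⟨i, b, φ, σ⟩ := ι
  obtain ⟨hs, hr, hu, ht, hf, hσ⟩ := h
  dsimp only at hs hr hu ht hf hσ
  cases φ with
  | rel => exact hA.elim
  | eq => exact hA.elim
  | neg φ =>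
    cases hA; cases hκ
    refine ⟨hs, hr, ?_, ht, hf, hσ⟩
    -- The sign flips while `Un` and `Ex` are exchanged, so the bound is literally the same.
    cases b <;> exact hu
  | conj I φ =>
    have hκ' : ∃ j, κ = ⟨i, b, φ j, σ⟩ := by
      cases b
      · cases hA; obtain ⟨j, rfl⟩ := hκ; exact ⟨j, rfl⟩
      · obtain ⟨j, rfl⟩ := hA; exact ⟨j, hκ⟩
    obtain ⟨j, rfl⟩ := hκ'
    refine ⟨(Set.subset_iUnion _ j).trans hs, (Set.subset_iUnion _ j).trans hr, ?_,
      fun ty hty => ht ty hty j, hf.subset (Set.subset_iUnion (fun j => (φ j).freeVars) j), hσ⟩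
    cases b
    · exact (Set.subset_iUnion (fun j => (φ j).Ex) j).trans hu
    · exact (Set.subset_iUnion (fun j => (φ j).Un) j).trans hu
  | disj I φ =>
    have hκ' : ∃ j, κ = ⟨i, b, φ j, σ⟩ := by
      cases b
      · obtain ⟨j, rfl⟩ := hA; exact ⟨j, hκ⟩
      · cases hA; obtain ⟨j, rfl⟩ := hκ; exact ⟨j, rfl⟩
    obtain ⟨j, rfl⟩ := hκ'
    refine ⟨(Set.subset_iUnion _ j).trans hs, (Set.subset_iUnion _ j).trans hr, ?_,
      fun ty hty => ht ty hty j, hf.subset (Set.subset_iUnion (fun j => (φ j).freeVars) j), hσ⟩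
    cases b
    · exact (Set.subset_iUnion (fun j => (φ j).Ex) j).trans hu
    · exact (Set.subset_iUnion (fun j => (φ j).Un) j).trans hu
  | all x φ =>
    have hκ' : ∃ n, κ = Item.inst i b x φ σ n := by
      cases b
      · cases hA; obtain ⟨j, rfl⟩ := hκ; exact ⟨j, rfl⟩
      · obtain ⟨j, rfl⟩ := hA; exact ⟨j, hκ⟩
    obtain ⟨n, rfl⟩ := hκ'
    refine Good.inst ((Set.subset_insert _ _).trans hs) hr ?_ ht hf hσ n
    cases b
    · exact hu
    · exact (Set.subset_insert _ _).trans hu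
  | ex x φ =>
    have hκ' : ∃ n, κ = Item.inst i b x φ σ n := by
      cases b
      · obtain ⟨j, rfl⟩ := hA; exact ⟨j, hκ⟩
      · cases hA; obtain ⟨j, rfl⟩ := hκ; exact ⟨j, rfl⟩
    obtain ⟨n, rfl⟩ := hκ'
    refine Good.inst ((Set.subset_insert _ _).trans hs) hr ?_ ht hf hσ n
    cases b
    · exact (Set.subset_insert _ _).trans hu
    · exact hu

end Item

section

variable {B : Bounds L} {Γ : Set (Item L)}

theorem exists_fresh_index (hfin : Γ.Finite) (hΓ : ∀ κ ∈ Γ, κ.Good B) (s : L.Srt) :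
    ∃ n, ∀ i, (⟨s, n⟩ : Var L) ∉ sideVars i Γ := by
  have hV : (⋃ ι ∈ Γ, ι.vars).Finite := hfin.biUnion fun ι hι => (hΓ ι hι).finite.image _
  obtain ⟨n, hn⟩ := (hV.image Var.index).exists_notMem
  refine ⟨n, fun i hi => hn ?_⟩
  obtain ⟨ι, hι, -, h⟩ := hi
  exact ⟨_, Set.mem_biUnion hι h, rfl⟩

/-- For an asserted `∃` or a denied `∀`, `A` holds the instances at all variables of the sort; the
one at a fresh variable suffices. -/
theorem separable_of_expand (hfin : Γ.Finite) (hΓ : ∀ κ ∈ Γ, κ.Good B) {ι : Item L} (hι : ι ∈ Γ)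
    {A : Set (Item L)} (hA : A ∈ ι.expand)
    (h : ∀ κ ∈ A, Separable.{u, v, w} B ι.side (insert κ Γ)) :
    Separable.{u, v, w} B ι.side Γ := by
  classical
  have hgood := hΓ ι hι
  obtain ⟨i, b, φ, σ⟩ := ι
  cases φ with
  | rel => exact hA.elim
  | eq => exact hA.elim
  | neg φ =>
    cases hA
    refine separable_of_branches (fun _ : Unit => ⟨i, !b, φ, σ⟩) hι (fun _ => rfl)
      (fun _ => subset_rfl) (fun M e _ hs => ⟨(), ?_⟩) fun _ => h _ rfl
    simp only [Item.Sat, Formula.Realize] at hs ⊢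
    cases b <;> simp_all
  | conj I φ =>
    cases b
    · cases hA
      refine separable_of_branches (fun j => ⟨i, false, φ j, σ⟩) hι (fun _ => rfl)
        (fun j => Set.image_mono (Set.subset_iUnion (fun j => (φ j).freeVars) j))
        (fun M e _ hs => ?_) fun j => h _ ⟨j, rfl⟩
      simpa [Item.Sat, Formula.Realize] using hs
    · obtain ⟨j, rfl⟩ := hA
      refine separable_of_branches (fun _ : Unit => ⟨i, true, φ j, σ⟩) hι (fun _ => rfl)
        (fun _ => Set.image_mono (Set.subset_iUnion (fun j => (φ j).freeVars) j))
        (fun M e _ hs => ⟨(), ?_⟩) fun _ => h _ rfl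
      exact iff_of_true (hs.2 rfl j) rfl
  | disj I φ =>
    cases b
    · obtain ⟨j, rfl⟩ := hA
      refine separable_of_branches (fun _ : Unit => ⟨i, false, φ j, σ⟩) hι (fun _ => rfl)
        (fun _ => Set.image_mono (Set.subset_iUnion (fun j => (φ j).freeVars) j))
        (fun M e _ hs => ⟨(), ?_⟩) fun _ => h _ rfl
      exact iff_of_false (fun hj => Bool.false_ne_true (hs.1 ⟨j, hj⟩)) Bool.false_ne_true
    · cases hA
      refine separable_of_branches (fun j => ⟨i, true, φ j, σ⟩) hι (fun _ => rfl)
        (fun j => Set.image_mono (Set.subset_iUnion (fun j => (φ j).freeVars) j))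
        (fun M e _ hs => ?_) fun j => h _ ⟨j, rfl⟩
      simpa [Item.Sat, Formula.Realize] using hs
  | all x φ =>
    cases b
    · cases hA
      obtain ⟨n, hn⟩ := exists_fresh_index hfin hΓ x.sort
      refine separable_of_witness (κ := Item.inst i false x φ σ n) hι rfl
        (Item.vars_inst_subset rfl) hn (fun M e _ hs => ?_) (h _ ⟨n, rfl⟩)
      have hex : ∃ a ∈ M.dom x.sort, ¬ φ.Realize M (Function.update (e ∘ σ) x a) := by
        simpa [Item.Sat, Formula.Realize] using hs
      obtain ⟨a, ha, hφ⟩ := hex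
      refine ⟨a, ha, fun e' he' hea => ?_⟩
      rw [Item.sat_inst, hea]
      refine iff_of_false (fun hφ' => hφ ((Formula.realize_congr M φ fun y hy => ?_).1 hφ'))
        Bool.false_ne_true
      by_cases hyx : y = x
      · subst hyx; simp
      · simp only [Function.update_of_ne hyx, Function.comp_apply]
        -- `σ y` is free in the item, so it is not the fresh variable.
        exact he' _ fun hy' => hn i ⟨_, hι, rfl, hy' ▸ ⟨y, ⟨hy, hyx⟩, rfl⟩⟩
    · obtain ⟨n, rfl⟩ := hA
      refine separable_of_instance (κ := Item.inst i true x φ σ n) hΓ hι rfl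
        (Item.vars_inst_subset rfl) (fun M e he hs => ?_) (hgood.sorts (Set.mem_insert _ _))
        (hgood.un (Set.mem_insert _ _)) (h _ rfl)
      rw [Item.sat_inst]
      exact iff_of_true (hs.2 rfl _ (he ⟨x.sort, n⟩)) rfl
  | ex x φ =>
    cases b
    · obtain ⟨n, rfl⟩ := hA
      refine separable_of_instance (κ := Item.inst i false x φ σ n) hΓ hι rfl
        (Item.vars_inst_subset rfl) (fun M e he hs => ?_) (hgood.sorts (Set.mem_insert _ _))
        (hgood.un (Set.mem_insert _ _)) (h _ rfl)
      rw [Item.sat_inst]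
      exact iff_of_false (fun hφ => Bool.false_ne_true (hs.1 ⟨_, he ⟨x.sort, n⟩, hφ⟩)) Bool.false_ne_true
    · cases hA
      obtain ⟨n, hn⟩ := exists_fresh_index hfin hΓ x.sort
      refine separable_of_witness (κ := Item.inst i true x φ σ n) hι rfl
        (Item.vars_inst_subset rfl) hn (fun M e _ hs => ?_) (h _ ⟨n, rfl⟩)
      obtain ⟨a, ha, hφ⟩ := hs.2 rfl
      refine ⟨a, ha, fun e' he' hea => ?_⟩
      rw [Item.sat_inst, hea]
      refine iff_of_true ((Formula.realize_congr M φ fun y hy => ?_).1 hφ) rfl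
      by_cases hyx : y = x
      · subst hyx; simp
      · simp only [Function.update_of_ne hyx, Function.comp_apply]
        exact (he' _ fun hy' => hn i ⟨_, hι, rfl, hy' ▸ ⟨y, ⟨hy, hyx⟩, rfl⟩⟩).symm

end

-- Equality and clashes

/-- The variables `a` and `b` are equated by an item on side `i`. -/
def Equated (Γ : Set (Item L)) (i : Bool) (a b : Var L) : Prop :=
  ∃ x y σ, (⟨i, true, .eq x y, σ⟩ : Item L) ∈ Γ ∧ a = σ x ∧ b = σ y

/-- The equivalence relation generated by the equations on side `i`. -/
def SideEqv (Γ : Set (Item L)) (i : Bool) : Var L → Var L → Prop :=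
  Relation.EqvGen (Equated Γ i)

/-- The equivalence relation generated by the equations on both sides. -/
def Eqv (Γ : Set (Item L)) : Var L → Var L → Prop :=
  Relation.EqvGen fun a b => ∃ i, Equated Γ i a b

section

variable {B : Bounds L} {Γ : Set (Item L)} {i : Bool}

theorem Eqv.mono {Γ' : Set (Item L)} (h : Γ ⊆ Γ') {a b : Var L} (hab : Eqv Γ a b) :
    Eqv Γ' a b :=
  Relation.EqvGen.mono (fun _ _ ⟨i, x, y, σ, hm, h1, h2⟩ => ⟨i, x, y, σ, h hm, h1, h2⟩) _ _ hab

theorem Equated.mem_sideVars {a b : Var L} (h : Equated Γ i a b) :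
    a ∈ sideVars i Γ ∧ b ∈ sideVars i Γ := by
  obtain ⟨x, y, σ, hm, rfl, rfl⟩ := h
  exact ⟨⟨_, hm, rfl, x, Or.inl rfl, rfl⟩, ⟨_, hm, rfl, y, Or.inr rfl, rfl⟩⟩

theorem Equated.eq_of_sideSat {M : Model.{u, v, w} L} {e : Var L → M.Carrier} {a b : Var L}
    (h : Equated Γ i a b) (hs : SideSat M e i Γ) : e a = e b := by
  obtain ⟨x, y, σ, hm, rfl, rfl⟩ := h
  exact (hs _ hm rfl).2 rfl

theorem SideEqv.eq_of_sideSat {M : Model.{u, v, w} L} {e : Var L → M.Carrier} {a b : Var L}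
    (h : SideEqv Γ i a b) (hs : SideSat M e i Γ) : e a = e b := by
  induction h with
  | rel a b h => exact h.eq_of_sideSat hs
  | refl => rfl
  | symm a b _ ih => exact ih.symm
  | trans a b c _ _ ih ih' => exact ih.trans ih'

theorem SideEqv.eq_or_mem {a b : Var L} (h : SideEqv Γ i a b) :
    a = b ∨ (a ∈ sideVars i Γ ∧ b ∈ sideVars i Γ) := by
  induction h with
  | rel a b h => exact Or.inr h.mem_sideVars
  | refl => exact Or.inl rfl
  | symm a b _ ih => exact ih.imp Eq.symm And.symm
  | trans a b c _ _ ih ih' =>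
    rcases ih with rfl | ih
    · exact ih'
    · rcases ih' with rfl | ih'
      · exact Or.inr ih
      · exact Or.inr ⟨ih.1, ih'.2⟩

theorem SideEqv.sort_eq (hΓ : ∀ κ ∈ Γ, κ.Good B) {ty : (R : L.Rel) → Fin (L.arity R) → L.Srt}
    (hty : ty ∈ B.typ) {a b : Var L} (h : SideEqv Γ i a b) : a.sort = b.sort := by
  induction h with
  | rel a b h =>
    obtain ⟨x, y, σ, hm, rfl, rfl⟩ := h
    have hg := hΓ _ hm
    exact (hg.sub x).trans ((hg.typ ty hty).trans (hg.sub y).symm)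
  | refl => rfl
  | symm a b _ ih => exact ih.symm
  | trans a b c _ _ ih ih' => exact ih.trans ih'

theorem sort_mem_of_mem_sideVars (hΓ : ∀ κ ∈ Γ, κ.Good B) {x : Var L} (hx : x ∈ sideVars i Γ) :
    x.sort ∈ B.srt i := by
  obtain ⟨κ, hκ, rfl, h⟩ := hx
  exact (hΓ κ hκ).sort_mem h

/-- The equations between common variables that hold on side `i` decide which variables of side
`!i` are identified by the equations of both sides. -/
theorem Eqv.eq_of_common {M : Model.{u, v, w} L} {e : Var L → M.Carrier}
    (hs : SideSat M e (!i) Γ)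
    (hcommon : ∀ a ∈ sideVars i Γ ∩ sideVars (!i) Γ, ∀ b ∈ sideVars i Γ ∩ sideVars (!i) Γ,
      SideEqv Γ i a b → e a = e b)
    {a b : Var L} (ha : a ∈ sideVars (!i) Γ) (hb : b ∈ sideVars (!i) Γ) (hab : Eqv Γ a b) :
    e a = e b := by
  have key : ∀ c ∈ sideVars (!i) Γ, ∀ d ∈ sideVars (!i) Γ, SideEqv Γ i c d → e c = e d := by
    intro c hc d hd h
    rcases h.eq_or_mem with rfl | h'
    · rfl
    · exact hcommon c ⟨h'.1, hc⟩ d ⟨h'.2, hd⟩ h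
  -- A chain of equations may pass through variables absent from side `!i`, about whose values
  -- nothing is known. The invariant replaces each link by its representatives: the variables of
  -- side `!i` equivalent to it by the equations of side `i`.
  suffices h : ((∃ c ∈ sideVars (!i) Γ, SideEqv Γ i a c) ↔ ∃ c ∈ sideVars (!i) Γ, SideEqv Γ i b c) ∧
      ∀ c ∈ sideVars (!i) Γ, ∀ d ∈ sideVars (!i) Γ, SideEqv Γ i a c → SideEqv Γ i b d →
        e c = e d from
    h.2 a ha b hb (.refl _) (.refl _)
  clear ha hb
  induction hab with
  | rel a b h =>
    obtain ⟨j, h⟩ := h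
    by_cases hj : j = i
    · subst hj
      have hab : SideEqv Γ j a b := .rel _ _ h
      exact ⟨⟨fun ⟨c, hc, h⟩ => ⟨c, hc, .trans _ _ _ (.symm _ _ hab) h⟩,
        fun ⟨c, hc, h⟩ => ⟨c, hc, .trans _ _ _ hab h⟩⟩,
        fun c hc d hd h h' => key c hc d hd
          (.trans _ _ _ (.symm _ _ h) (.trans _ _ _ hab h'))⟩
    · obtain rfl : j = !i := by revert hj; cases i <;> cases j <;> simp
      have hm := h.mem_sideVars
      exact ⟨iff_of_true ⟨a, hm.1, .refl _⟩ ⟨b, hm.2, .refl _⟩, fun c hc d hd hac hbd =>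
        (key a hm.1 c hc hac).symm.trans ((h.eq_of_sideSat hs).trans (key b hm.2 d hd hbd))⟩
  | refl a =>
    exact ⟨Iff.rfl, fun c hc d hd h h' => key c hc d hd (.trans _ _ _ (.symm _ _ h) h')⟩
  | symm a b _ ih => exact ⟨ih.1.symm, fun c hc d hd h h' => (ih.2 d hd c hc h' h).symm⟩
  | trans a b c _ _ ih ih' =>
    refine ⟨ih.1.trans ih'.1, fun d hd d' hd' h h' => ?_⟩
    obtain ⟨f, hf, hbf⟩ := ih.1.1 ⟨d, hd, h⟩
    exact (ih.2 d hd f hf h hbf).trans (ih'.2 f hf d' hd' hbf h')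

/-- Supplies common variables to replace the arguments of an asserted atom in
`separable_of_rel_clash`. -/
theorem Eqv.exists_sideEqv {a b : Var L} (hb : b ∈ sideVars (!i) Γ) (hab : Eqv Γ a b) :
    ∃ c ∈ sideVars (!i) Γ, SideEqv Γ i a c := by
  suffices h : (∃ c ∈ sideVars (!i) Γ, SideEqv Γ i a c) ↔
      ∃ c ∈ sideVars (!i) Γ, SideEqv Γ i b c from h.2 ⟨b, hb, .refl _⟩
  clear hb
  induction hab with
  | rel a b h =>
    obtain ⟨j, h⟩ := h
    by_cases hj : j = i
    · subst hj
      have hab : SideEqv Γ j a b := .rel _ _ h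
      exact ⟨fun ⟨c, hc, h⟩ => ⟨c, hc, .trans _ _ _ (.symm _ _ hab) h⟩,
        fun ⟨c, hc, h⟩ => ⟨c, hc, .trans _ _ _ hab h⟩⟩
    · obtain rfl : j = !i := by revert hj; cases i <;> cases j <;> simp
      exact iff_of_true ⟨a, h.mem_sideVars.1, .refl _⟩ ⟨b, h.mem_sideVars.2, .refl _⟩
  | refl a => exact Iff.rfl
  | symm a b _ ih => exact ih.symm
  | trans a b c _ _ ih ih' => exact ih.trans ih'

theorem finite_sideVars (hfin : Γ.Finite) (hΓ : ∀ κ ∈ Γ, κ.Good B) : (sideVars i Γ).Finite := by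
  refine (hfin.biUnion fun ι hι => (hΓ ι hι).finite.image _).subset
    (s := ⋃ ι ∈ Γ, ι.vars) ?_
  rintro x ⟨ι, hι, -, h⟩
  exact Set.mem_biUnion hι h

/-- A formula `χ` that follows from side `i` gives rise to an interpolant if, in the presence of the
equations of both sides, it is refuted by side `!i`. -/
theorem separable_of_equations (hfin : Γ.Finite) (hΓ : ∀ κ ∈ Γ, κ.Good B) (χ : Formula L)
    (hfree : χ.freeVars ⊆ sideVars i Γ ∩ sideVars (!i) Γ) (hfits : B.Fits i χ)
    (hleft : ∀ (M : Model.{u, v, w} L) (e : Var L → M.Carrier), SideSat M e i Γ → χ.Realize M e)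
    (hright : ∀ (M : Model.{u, v, w} L) (e : Var L → M.Carrier), SideSat M e (!i) Γ →
      (∀ a ∈ sideVars (!i) Γ, ∀ b ∈ sideVars (!i) Γ, Eqv Γ a b → e a = e b) →
      ¬ χ.Realize M e) :
    Separable.{u, v, w} B i Γ := by
  let V := sideVars i Γ ∩ sideVars (!i) Γ
  have hV : V.Finite := (finite_sideVars hfin hΓ).inter_of_left _
  -- The separator conjoins `χ`, at index `none`, with all equations between common variables that
  -- the equations of side `i` entail.
  let J := {p : V × V // SideEqv Γ i p.1 p.2}
  have : Countable V := hV.countable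
  let f : Option J → Formula L := fun o => o.elim χ fun p => .eq (p.1.1 : Var L) p.1.2
  refine ⟨Formula.cConj f, Formula.freeVars_cConj_subset ?_, Bounds.Fits.cConj ?_,
    fun M e _ hs => (Formula.realize_cConj _ _ _).2 ?_,
    fun M e _ hs hθ => ?_⟩
  · rintro (_ | ⟨⟨a, b⟩, hab⟩)
    · exact hfree
    · rintro x (rfl | rfl)
      exacts [a.2, b.2]
  · rintro (_ | ⟨⟨a, b⟩, hab⟩)
    · exact hfits
    · refine ⟨?_, Set.empty_subset _, Set.empty_subset _, Set.empty_subset _,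
        fun ty hty => hab.sort_eq hΓ hty⟩
      rintro s (rfl | rfl)
      exacts [⟨sort_mem_of_mem_sideVars hΓ a.2.1, sort_mem_of_mem_sideVars hΓ a.2.2⟩,
        ⟨sort_mem_of_mem_sideVars hΓ b.2.1, sort_mem_of_mem_sideVars hΓ b.2.2⟩]
  · rintro (_ | ⟨⟨a, b⟩, hab⟩)
    · exact hleft M e hs
    · exact hab.eq_of_sideSat hs
  · rw [Formula.realize_cConj] at hθ
    refine hright M e hs (fun a ha b hb hab => ?_) (hθ none)
    exact Eqv.eq_of_common hs (fun c hc d hd hcd => hθ (some ⟨(⟨c, hc⟩, ⟨d, hd⟩), hcd⟩)) ha hb hab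

/-- A contradiction between the equations of both sides and the rest of side `!i` gives rise to an
interpolant. -/
theorem separable_of_refutes_equations (hfin : Γ.Finite) (hΓ : ∀ κ ∈ Γ, κ.Good B)
    (hright : ∀ (M : Model.{u, v, w} L) (e : Var L → M.Carrier), SideSat M e (!i) Γ →
      ¬ ∀ a ∈ sideVars (!i) Γ, ∀ b ∈ sideVars (!i) Γ, Eqv Γ a b → e a = e b) :
    Separable.{u, v, w} B i Γ := by
  -- The empty conjunction serves as a true `χ`.
  refine separable_of_equations hfin hΓ (Formula.cConj Empty.elim)
    (Formula.freeVars_cConj_subset fun j => j.elim) (Bounds.Fits.cConj fun j => j.elim)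
    (fun M e _ => (Formula.realize_cConj _ _ _).2 fun j => j.elim)
    fun M e hs h => (hright M e hs h).elim

theorem separable_of_eq_clash (hfin : Γ.Finite) (hΓ : ∀ κ ∈ Γ, κ.Good B) {x y : Var L}
    {σ : Var L → Var L} (hm : (⟨!i, false, .eq x y, σ⟩ : Item L) ∈ Γ)
    (hxy : Eqv Γ (σ x) (σ y)) : Separable.{u, v, w} B i Γ :=
  separable_of_refutes_equations hfin hΓ fun _ _ hs h => Bool.false_ne_true <|
    (hs _ hm rfl).1 <| h _ ⟨_, hm, rfl, x, Or.inl rfl, rfl⟩ _ ⟨_, hm, rfl, y, Or.inr rfl, rfl⟩ hxy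

theorem separable_of_rel_clash (hfin : Γ.Finite) (hΓ : ∀ κ ∈ Γ, κ.Good B) {R : L.Rel}
    {x y : Fin (L.arity R) → Var L} {σ τ : Var L → Var L} {j : Bool}
    (hx : (⟨!i, false, .rel R x, σ⟩ : Item L) ∈ Γ) (hy : (⟨j, true, .rel R y, τ⟩ : Item L) ∈ Γ)
    (hxy : ∀ k, Eqv Γ (τ (y k)) (σ (x k))) : Separable.{u, v, w} B i Γ := by
  have hxm : ∀ k, σ (x k) ∈ sideVars (!i) Γ := fun k => ⟨_, hx, rfl, x k, ⟨k, rfl⟩, rfl⟩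
  have hym : ∀ k, τ (y k) ∈ sideVars j Γ := fun k => ⟨_, hy, rfl, y k, ⟨k, rfl⟩, rfl⟩
  -- If the atoms stand on opposite sides, the separator needs the atom `R` applied to common
  -- representatives `c`; if both stand on side `!i`, equations suffice.
  by_cases hj : j = i
  · subst hj
    have hex := fun k => (hxy k).exists_sideEqv (hxm k)
    choose c hc hyc using hex
    have hcj : ∀ k, c k ∈ sideVars j Γ := fun k => by
      rcases (hyc k).eq_or_mem with h | h
      · exact h ▸ hym k
      · exact h.2
    have heq : ∀ k, Eqv Γ (c k) (σ (x k)) := fun k =>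
      .trans _ _ _ (.symm _ _ (Relation.EqvGen.mono (fun _ _ h => ⟨j, h⟩) _ _ (hyc k))) (hxy k)
    refine separable_of_equations hfin hΓ (.rel R c) ?_ ⟨?_, ?_, Set.empty_subset _,
      Set.empty_subset _, fun ty hty k => ?_⟩ (fun M e hs => ?_) fun M e hs he hR => ?_
    · rintro _ ⟨k, rfl⟩
      exact ⟨hcj k, hc k⟩
    · rintro _ ⟨k, rfl⟩
      exact ⟨sort_mem_of_mem_sideVars hΓ (hcj k), sort_mem_of_mem_sideVars hΓ (hc k)⟩
    · refine Set.singleton_subset_iff.2 ?_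
      exact ⟨(hΓ _ hy).relSymbols rfl, (hΓ _ hx).relSymbols rfl⟩
    · exact ((hyc k).sort_eq hΓ hty).symm.trans
        (((hΓ _ hy).sub (y k)).trans ((hΓ _ hy).typ ty hty k))
    · have : (fun k => e (c k)) = fun k => e (τ (y k)) :=
        funext fun k => ((hyc k).eq_of_sideSat hs).symm
      rw [Formula.Realize, this]
      exact (hs _ hy rfl).2 rfl
    · have : (fun k => e (c k)) = fun k => e (σ (x k)) :=
        funext fun k => he _ (hc k) _ (hxm k) (heq k)
      rw [Formula.Realize, this] at hR
      exact Bool.false_ne_true ((hs _ hx rfl).1 hR)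
  · obtain rfl : j = !i := by revert hj; cases i <;> cases j <;> simp
    refine separable_of_refutes_equations hfin hΓ fun M e hs he => ?_
    have : (fun k => e (τ (y k))) = fun k => e (σ (x k)) :=
      funext fun k => he _ (hym k) _ (hxm k) (hxy k)
    have hR : M.rel R fun k => e (τ (y k)) := (hs _ hy rfl).2 rfl
    rw [this] at hR
    exact Bool.false_ne_true ((hs _ hx rfl).1 hR)

end

-- Open branches and Hintikka sets

/-- The items reached from `Γ` by tableau rules. -/
inductive Reachable (Γ : Set (Item L)) : Item L → Prop
  | base {ι : Item L} : ι ∈ Γ → Reachable Γ ι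
  | step {ι κ : Item L} {A : Set (Item L)} :
    Reachable Γ ι → A ∈ ι.expand → κ ∈ A → Reachable Γ κ

/-- The vocabulary may be uncountable; this is what lets all rule applications be scheduled in `ω`
steps. -/
theorem countable_reachable {Γ : Set (Item L)} (hΓ : Γ.Countable) :
    {ι | Reachable Γ ι}.Countable := by
  let N : ℕ → Set (Item L) := fun n =>
    Nat.rec Γ (fun _ S => ⋃ ι ∈ S, ⋃ A ∈ ι.expand, A) n
  have hN : ∀ n, (N n).Countable := by
    intro n
    induction n with
    | zero => exact hΓ
    | succ n ih =>
      exact ih.biUnion fun ι _ => ι.countable_expand.biUnion fun A hA =>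
        Item.countable_of_mem_expand hA
  refine (Set.countable_iUnion hN).mono fun ι hι => ?_
  induction hι with
  | base h => exact Set.mem_iUnion_of_mem 0 h
  | step _ hA hκ ih =>
    obtain ⟨n, hn⟩ := Set.mem_iUnion.1 ih
    exact Set.mem_iUnion_of_mem (n + 1) (Set.mem_biUnion hn (Set.mem_biUnion hA hκ))

theorem Reachable.good {B : Bounds L} {Γ : Set (Item L)} (hΓ : ∀ ι ∈ Γ, ι.Good B) {ι : Item L}
    (h : Reachable Γ ι) : ι.Good B := by
  induction h with
  | base h => exact hΓ _ h
  | step _ hA hκ ih => exact ih.of_mem_expand hA hκ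

/-- A finite inseparable set of good items lies on an open branch of a systematic tableau. -/
theorem exists_open_branch {B : Bounds L} {Γ : Set (Item L)} (hfin : Γ.Finite)
    (hΓ : ∀ ι ∈ Γ, ι.Good B) (hsep : ¬ Separable.{u, v, w} B true Γ) :
    ∃ G : ℕ → Set (Item L), Monotone G ∧ Γ ⊆ G 0 ∧
      (∀ n, (G n).Finite ∧ (∀ ι ∈ G n, Reachable Γ ι) ∧ ¬ Separable.{u, v, w} B true (G n)) ∧
      ∀ n, ∀ ι ∈ G n, ∀ A ∈ ι.expand, ∃ κ ∈ A, ∃ m, κ ∈ G m := by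
  let P := {S : Set (Item L) //
    S.Finite ∧ (∀ ι ∈ S, Reachable Γ ι) ∧ ¬ Separable.{u, v, w} B true S}
  let K : Set (Item L × Set (Item L)) :=
    ⋃ ι ∈ {ι | Reachable Γ ι}, (fun A => (ι, A)) '' ι.expand
  have hK : K.Countable := (countable_reachable hfin.countable).biUnion fun ι _ =>
    ι.countable_expand.image _
  have : Encodable K := hK.toEncodable
  -- As in the Rasiowa–Sikorski lemma: a condition either meets the requirement or rules out that
  -- `ι` ever appears in an extension.
  let D : K → Order.Cofinal P := fun k =>
    { carrier := {S | (∃ κ ∈ k.1.2, κ ∈ S.1) ∨ ∀ T : P, S ≤ T → k.1.1 ∉ T.1}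
      isCofinal := by
        intro S
        by_cases hS : ∀ T : P, S ≤ T → k.1.1 ∉ T.1
        · exact ⟨S, Or.inr hS, le_rfl⟩
        push Not at hS
        obtain ⟨T, hST, hT⟩ := hS
        obtain ⟨⟨ι, A⟩, hk⟩ := k
        have hA : Reachable Γ ι ∧ A ∈ ι.expand := by
          simp only [K, Set.mem_iUnion] at hk
          obtain ⟨ι', hι', A', hA', h⟩ := hk
          cases h
          exact ⟨hι', hA'⟩
        have hκ : ∃ κ ∈ A, ¬ Separable.{u, v, w} B true (insert κ T.1) := by
          by_contra! hcon
          exact T.2.2.2 ((separable_of_expand T.2.1 (fun κ hκ => (T.2.2.1 κ hκ).good hΓ) hT hA.2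
            fun κ hκ => (hcon κ hκ).change_side _).change_side true)
        obtain ⟨κ, hκA, hκ⟩ := hκ
        refine ⟨⟨insert κ T.1, T.2.1.insert κ, ?_, hκ⟩, Or.inl ⟨κ, hκA, Or.inl rfl⟩,
          hST.trans (Set.subset_insert _ _)⟩
        rintro ι' (rfl | h)
        · exact hA.1.step hA.2 hκA
        · exact T.2.2.1 _ h }
  let p : P := ⟨Γ, hfin, fun _ => .base, hsep⟩
  have hmono := Order.sequenceOfCofinals.monotone p D
  refine ⟨fun n => (Order.sequenceOfCofinals p D n).1, hmono, subset_rfl,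
    fun n => (Order.sequenceOfCofinals p D n).2, fun n ι hι A hA => ?_⟩
  have hk : (ι, A) ∈ K :=
    Set.mem_biUnion ((Order.sequenceOfCofinals p D n).2.2.1 ι hι) ⟨A, hA, rfl⟩
  rcases Order.sequenceOfCofinals.encode_mem p D ⟨_, hk⟩ with ⟨κ, hκ, h⟩ | h
  · exact ⟨κ, hκ, _, h⟩
  · exact absurd (hmono (le_max_right _ _) hι) (h _ (hmono (le_max_left _ n)))

/-- A Hintikka set: a set of items closed under the tableau rules and free of clashes. -/
structure IsHintikka (H : Set (Item L)) : Prop where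
  expand : ∀ ι ∈ H, ∀ A ∈ ι.expand, ∃ κ ∈ A, κ ∈ H
  eq : ∀ i x y σ, (⟨i, false, .eq x y, σ⟩ : Item L) ∈ H → ¬ Eqv H (σ x) (σ y)
  rel : ∀ i j R x y σ τ, (⟨i, false, .rel R x, σ⟩ : Item L) ∈ H →
    (⟨j, true, .rel R y, τ⟩ : Item L) ∈ H → ¬ ∀ k, Eqv H (τ (y k)) (σ (x k))

/-- A chain of equations is finite, so it already lives in some stage. -/
theorem exists_eqv_of_eqv_iUnion {G : ℕ → Set (Item L)} (hG : Monotone G) {a b : Var L}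
    (h : Eqv (⋃ n, G n) a b) : ∃ n, Eqv (G n) a b := by
  induction h with
  | rel a b h =>
    obtain ⟨i, x, y, σ, hm, h⟩ := h
    obtain ⟨n, hn⟩ := Set.mem_iUnion.1 hm
    exact ⟨n, .rel _ _ ⟨i, x, y, σ, hn, h⟩⟩
  | refl => exact ⟨0, .refl _⟩
  | symm a b _ ih => exact ih.imp fun n h => .symm _ _ h
  | trans a b c _ _ ih ih' =>
    obtain ⟨n, hn⟩ := ih
    obtain ⟨m, hm⟩ := ih'
    exact ⟨max n m, .trans _ _ _ (Eqv.mono (hG (le_max_left _ _)) hn)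
      (Eqv.mono (hG (le_max_right _ _)) hm)⟩

theorem exists_isHintikka {B : Bounds L} {Γ : Set (Item L)} (hfin : Γ.Finite)
    (hΓ : ∀ ι ∈ Γ, ι.Good B) (hsep : ¬ Separable.{u, v, w} B true Γ) :
    ∃ H, IsHintikka H ∧ Γ ⊆ H ∧ H.Countable ∧ ∀ ι ∈ H, ι.Good B := by
  obtain ⟨G, hmono, hΓG, hG, hexp⟩ := exists_open_branch hfin hΓ hsep
  have hgood : ∀ n, ∀ ι ∈ G n, ι.Good B := fun n ι hι => ((hG n).2.1 ι hι).good hΓ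
  have hnot : ∀ (i : Bool) n, ¬ Separable.{u, v, w} B i (G n) := fun i n h =>
    (hG n).2.2 (h.change_side true)
  refine ⟨⋃ n, G n, ⟨?_, ?_, ?_⟩, hΓG.trans (Set.subset_iUnion G 0),
    Set.countable_iUnion fun n => (hG n).1.countable, ?_⟩
  · intro ι hι A hA
    obtain ⟨n, hn⟩ := Set.mem_iUnion.1 hι
    obtain ⟨κ, hκ, m, hm⟩ := hexp n ι hn A hA
    exact ⟨κ, hκ, Set.mem_iUnion_of_mem m hm⟩
  · intro i x y σ hm hxy
    obtain ⟨n, hn⟩ := Set.mem_iUnion.1 hm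
    obtain ⟨m, hm⟩ := exists_eqv_of_eqv_iUnion hmono hxy
    refine hnot (!i) (max n m) (separable_of_eq_clash (hG _).1 (hgood _) (x := x) (y := y) (σ := σ)
      ?_ (hm.mono (hmono (le_max_right _ _))))
    rw [Bool.not_not]
    exact hmono (le_max_left _ _) hn
  · intro i j R x y σ τ hx hy hxy
    obtain ⟨n, hn⟩ := Set.mem_iUnion.1 hx
    obtain ⟨m, hm⟩ := Set.mem_iUnion.1 hy
    choose f hf using fun k => exists_eqv_of_eqv_iUnion hmono (hxy k)
    -- Arities are finite, so one stage contains both atoms and all the equivalences.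
    let q := max (max n m) (Finset.univ.sup f)
    refine hnot (!i) q (separable_of_rel_clash (hG _).1 (hgood _) (x := x) (y := y) (σ := σ)
      (τ := τ) (j := j) ?_ (hmono ((le_max_right n m).trans (le_max_left _ _)) hm) fun k =>
        (hf k).mono (hmono ((Finset.le_sup (Finset.mem_univ k)).trans (le_max_right _ _))))
    rw [Bool.not_not]
    exact hmono ((le_max_left n m).trans (le_max_left _ _)) hn
  · intro ι hι
    obtain ⟨n, hn⟩ := Set.mem_iUnion.1 hι
    exact hgood n ι hn

-- The canonical model

/-- A function that names the elements of the canonical model of `H`. -/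
theorem exists_naming {B : Bounds L} {H : Set (Item L)} (hH : H.Countable)
    (hgood : ∀ ι ∈ H, ι.Good B) :
    ∃ h : Var L → ULift.{w} ℕ, (∀ a b, Eqv H a b → h a = h b) ∧
      ∀ ι ∈ H, ∀ κ ∈ H, ∀ a ∈ ι.vars, ∀ b ∈ κ.vars, h a = h b → Eqv H a b := by
  let s : Setoid (Var L) := ⟨Eqv H, Relation.EqvGen.is_equivalence _⟩
  have hV : (⋃ ι ∈ H, ι.vars).Countable := hH.biUnion fun ι hι =>
    ((hgood ι hι).finite.image _).countable
  -- Injectivity is asked only on classes of occurring variables; there may be uncountably many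
  -- others, and these may be collapsed.
  obtain ⟨f, hf⟩ := Set.countable_iff_exists_injOn.1 (hV.image (Quotient.mk s))
  refine ⟨fun a => ⟨f (Quotient.mk s a)⟩, fun a b hab => ?_, fun ι hι κ hκ a ha b hb hab => ?_⟩
  · exact congrArg (fun q => ULift.up (f q)) (Quotient.sound (s := s) hab)
  · exact Quotient.exact (hf ⟨a, Set.mem_biUnion hι ha, rfl⟩ ⟨b, Set.mem_biUnion hκ hb, rfl⟩
      (ULift.up_injective hab))

/-- The canonical model of a set of items; its elements are the values of `h`. -/
def canonicalModel (H : Set (Item L)) (h : Var L → ULift.{w} ℕ) : Model.{u, v, w} L where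
  Carrier := Set.range h
  dom s := {a | ∃ x : Var L, x.sort = s ∧ h x = a}
  dom_nonempty s := ⟨⟨h ⟨s, 0⟩, _, rfl⟩, ⟨s, 0⟩, rfl, rfl⟩
  exists_mem_dom := by
    rintro ⟨_, x, rfl⟩
    exact ⟨x.sort, x, rfl, rfl⟩
  rel R a := ∃ i y τ, (⟨i, true, .rel R y, τ⟩ : Item L) ∈ H ∧ ∀ k, h (τ (y k)) = a k

theorem IsHintikka.sat {H : Set (Item L)} (hH : IsHintikka H) {h : Var L → ULift.{w} ℕ}
    (heq : ∀ a b, Eqv H a b → h a = h b)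
    (heqv : ∀ ι ∈ H, ∀ κ ∈ H, ∀ a ∈ ι.vars, ∀ b ∈ κ.vars, h a = h b → Eqv H a b) :
    ∀ ι ∈ H, ι.Sat (canonicalModel H h) (Set.rangeFactorization h) := by
  classical
  rintro ⟨i, b, φ, σ⟩
  induction φ generalizing b σ with
  | rel R x =>
    intro hι
    cases b
    · refine iff_of_false ?_ Bool.false_ne_true
      rintro ⟨j, y, τ, hm, hk⟩
      exact hH.rel _ _ _ _ _ _ _ hι hm fun k =>
        heqv _ hm _ hι _ ⟨y k, ⟨k, rfl⟩, rfl⟩ _ ⟨x k, ⟨k, rfl⟩, rfl⟩ (hk k)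
    · exact iff_of_true ⟨i, x, σ, hι, fun k => rfl⟩ rfl
  | eq x y =>
    intro hι
    cases b
    · refine iff_of_false (fun hxy => ?_) Bool.false_ne_true
      exact hH.eq _ _ _ _ hι (heqv _ hι _ hι _ ⟨x, Or.inl rfl, rfl⟩ _ ⟨y, Or.inr rfl, rfl⟩
        (congrArg Subtype.val hxy))
    · exact iff_of_true (Subtype.ext (heq _ _ (.rel _ _ ⟨i, x, y, σ, hι, rfl, rfl⟩))) rfl
  | neg φ ih =>
    intro hι
    obtain ⟨_, rfl, hκ⟩ := hH.expand _ hι _ rfl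
    have := ih _ _ hκ
    simp only [Item.Sat, Formula.Realize] at this ⊢
    rw [this]
    cases b <;> simp
  | conj I φ ih =>
    intro hι
    cases b
    · obtain ⟨_, ⟨j, rfl⟩, hκ⟩ := hH.expand _ hι _ rfl
      exact iff_of_false (fun hall => Bool.false_ne_true ((ih j _ _ hκ).1 (hall j)))
        Bool.false_ne_true
    · refine iff_of_true (fun j => ?_) rfl
      obtain ⟨_, rfl, hκ⟩ := hH.expand _ hι _ ⟨j, rfl⟩
      exact (ih j _ _ hκ).2 rfl
  | disj I φ ih =>
    intro hι
    cases b
    · refine iff_of_false ?_ Bool.false_ne_true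
      rintro ⟨j, hj⟩
      obtain ⟨_, rfl, hκ⟩ := hH.expand _ hι _ ⟨j, rfl⟩
      exact Bool.false_ne_true ((ih j _ _ hκ).1 hj)
    · obtain ⟨_, ⟨j, rfl⟩, hκ⟩ := hH.expand _ hι _ rfl
      exact iff_of_true ⟨j, (ih j _ _ hκ).2 rfl⟩ rfl
  | all x φ ih =>
    intro hι
    cases b
    · obtain ⟨_, ⟨n, rfl⟩, hκ⟩ := hH.expand _ hι _ rfl
      have := Item.sat_inst.1 (ih _ _ hκ)
      exact iff_of_false (fun hall => Bool.false_ne_true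
        (this.1 (hall _ ⟨⟨x.sort, n⟩, rfl, rfl⟩))) Bool.false_ne_true
    · refine iff_of_true ?_ rfl
      -- Every element of the domain is named by a variable of that sort, and the rule instantiates
      -- at all of them.
      rintro ⟨_, _⟩ ⟨⟨s, n⟩, hs, rfl⟩
      cases hs
      obtain ⟨_, rfl, hκ⟩ := hH.expand _ hι _ ⟨n, rfl⟩
      exact (Item.sat_inst.1 (ih _ _ hκ)).2 rfl
  | ex x φ ih =>
    intro hι
    cases b
    · refine iff_of_false ?_ Bool.false_ne_true
      rintro ⟨⟨_, _⟩, ⟨⟨s, n⟩, hs, rfl⟩, hφ⟩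
      cases hs
      obtain ⟨_, rfl, hκ⟩ := hH.expand _ hι _ ⟨n, rfl⟩
      exact Bool.false_ne_true ((Item.sat_inst.1 (ih _ _ hκ)).1 hφ)
    · obtain ⟨_, ⟨n, rfl⟩, hκ⟩ := hH.expand _ hι _ rfl
      have := Item.sat_inst.1 (ih _ _ hκ)
      exact iff_of_true ⟨_, ⟨⟨x.sort, n⟩, rfl, rfl⟩, this.2 rfl⟩ rfl

/-- The model is countable and lifted to universe `w`, so entailment over structures in any single
universe is enough. -/
theorem exists_model_of_not_separable {B : Bounds L} {Γ : Set (Item L)} (hfin : Γ.Finite)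
    (hΓ : ∀ ι ∈ Γ, ι.Good B) (hsep : ¬ Separable.{u, v, w} B true Γ) :
    ∃ (M : Model.{u, v, w} L) (e : Var L → M.Carrier), M.Respects e ∧ ∀ ι ∈ Γ, ι.Sat M e := by
  obtain ⟨H, hH, hΓH, hcount, hgood⟩ := exists_isHintikka hfin hΓ hsep
  obtain ⟨h, heq, heqv⟩ := exists_naming.{u, v, w} hcount hgood
  exact ⟨canonicalModel H h, Set.rangeFactorization h, fun x => ⟨x, rfl, rfl⟩,
    fun ι hι => hH.sat heq heqv ι (hΓH hι)⟩

end ManySorted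

-- The interpolation theorem

theorem mainTheorem8 (L : ManySorted.Vocabulary.{u, v}) (φ ψ : ManySorted.Formula L)
    (hφ : φ.IsSentence) (hψ : ψ.IsSentence)
    (h : ManySorted.Formula.Entails.{u, v, w} φ ψ) :
    ∃ θ : ManySorted.Formula L, θ.IsSentence ∧
      ManySorted.Formula.Entails.{u, v, w} φ θ ∧
      ManySorted.Formula.Entails.{u, v, w} θ ψ ∧
      θ.voc ⊆ φ.voc ∩ ψ.voc ∧
      θ.Un ⊆ φ.Un ∧
      θ.Ex ⊆ ψ.Ex ∧
      ∀ ty : (R : L.Rel) → Fin (L.arity R) → L.Srt,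
        φ.RespectsType ty → ψ.RespectsType ty → θ.RespectsType ty := by
  open ManySorted in
  -- As `ψ` is denied, its existential quantifiers act universally on side `false`.
  let B : Bounds L :=
    { srt := fun i => if i then φ.sorts else ψ.sorts
      rels := fun i => if i then φ.relSymbols else ψ.relSymbols
      un := fun i => if i then φ.Un else ψ.Ex
      typ := {ty | φ.RespectsType ty ∧ ψ.RespectsType ty} }
  let ι : Item L := ⟨true, true, φ, id⟩
  let κ : Item L := ⟨false, false, ψ, id⟩
  have hι : ι.Good B := ⟨subset_rfl, subset_rfl, subset_rfl, fun _ h => h.1,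
    hφ ▸ Set.finite_empty, fun _ => rfl⟩
  have hκ : κ.Good B := ⟨subset_rfl, subset_rfl, subset_rfl, fun _ h => h.2,
    hψ ▸ Set.finite_empty, fun _ => rfl⟩
  have hsep : Separable.{u, v, w} B true {ι, κ} := by
    by_contra hcon
    obtain ⟨M, e, he, hs⟩ := exists_model_of_not_separable (Γ := {ι, κ}) (by simp)
      (by rintro _ (rfl | rfl) <;> assumption) hcon
    refine Bool.false_ne_true ((hs κ (by simp)).1 (h M (fun e' _ => ?_) e he))
    exact (Formula.realize_congr M φ fun x hx => by rw [hφ] at hx; exact hx.elim).1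
      ((hs ι (by simp)).2 rfl)
  obtain ⟨θ, hθ⟩ := hsep
  refine ⟨θ, ?_, fun M hM e he => ?_, fun M hM e he => ?_, ?_, hθ.fits.un, hθ.fits.ex,
    fun ty h1 h2 => hθ.fits.typ ty ⟨h1, h2⟩⟩
  · refine Set.eq_empty_of_subset_empty fun x hx => ?_
    obtain ⟨_, rfl | rfl, hside, y, hy, -⟩ := (hθ.freeVars hx).1
    · change y ∈ φ.freeVars at hy
      rwa [hφ] at hy
    · change y ∈ ψ.freeVars at hy
      rwa [hψ] at hy
  · refine hθ.left M e he ?_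
    rintro _ (rfl | rfl) hside
    · exact iff_of_true (hM e he) rfl
    · cases hside
  · by_contra hn
    refine hθ.right M e he ?_ (hM e he)
    rintro _ (rfl | rfl) hside
    · cases hside
    · exact iff_of_false hn Bool.false_ne_true
  · rintro _ (⟨s, hs, rfl⟩ | ⟨R, hR, rfl⟩)
    · exact ⟨Or.inl ⟨s, (hθ.fits.sorts hs).1, rfl⟩, Or.inl ⟨s, (hθ.fits.sorts hs).2, rfl⟩⟩
    · exact ⟨Or.inr ⟨R, (hθ.fits.relSymbols hR).1, rfl⟩,
        Or.inr ⟨R, (hθ.fits.relSymbols hR).2, rfl⟩⟩
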